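/- Let $m\ge 0$ be an integer. On words over the alphabet $\{a,b\}$ let $h$ be the additive valuation with $h(a)=2m+1$ and $h(b)=-2$. A word $w$ is a generalized Dyck word (of slope $\frac{2m+1}{2}$) if $h(w)=0$ and $h(w_1)\ge 0$ for every prefix $w_1$ of $w$; it is factor-free if it has no nonempty proper factor (that is, no nonempty contiguous subword other than $w$ itself) that is a generalized Dyck word. For $n\ge 1$ let $\theta_n$ be the number of factor-free generalized Dyck words of length $(2m+3)n$. Then the generating function $\sum_w \tau^{|w|}$ over all factor-free generalized Dyck words $w$ (including the empty word), where $|w|$ is the length of $w$, equals $\mathcal D(\tau^{2m+3})$ with $$\mathcal D(t)=1+\sum_{n\ge 1}\theta_n t^n,$$ and for every $n\ge 1$ $$\theta_n=\sum_{\ell=0}^{\min(m,n-1)}\binom{m+\ell+1}{m-\ell}\,\Delta_{n-\ell-1,\ell},$$ where $$\Delta_{\nu,\ell}=\frac{2\ell+1}{2\nu+2\ell+1}\sum_{k=0}^{\nu}\binom{2\nu+2\ell+1}{k}\frac{k!}{\nu!}\,B_{\nu,k}(1!\mu_1,2!\mu_2,\dots),$$ $\mu_j=\binom{m+j}{m-j}$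 for $1\le j\le m$, $\mu_j=0$ for $j>m$, and $B_{n,k}$ denotes the partial Bell polynomial $$B_{n,k}(z_1,z_2,\dots)=\sum\frac{n!}{j_1!\,j_2!\cdots}\Big(\frac{z_1}{1!}\Big)^{j_1}\Big(\frac{z_2}{2!}\Big)^{j_2}\cdots,$$ the sum being over all integers $j_1,j_2,\dots\ge 0$ with $\sum_i j_i=k$ and $\sum_i i\,j_i=n$. -/

import Mathlib

namespace FactorFreeDyck

/-- The two-letter alphabet `{a, b}`. -/
inductive Letter
  | a
  | b
  deriving DecidableEq

instance : Fintype Letter :=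
  ⟨{Letter.a, Letter.b}, fun x => by cases x <;> simp⟩

/-- The valuation `h(w)` of a word, extended additively from the letters. -/
def valuation {α : Type*} (h : α → ℤ) (w : List α) : ℤ :=
  (w.map h).sum

/-- The generalized Dyck words for `h`: total valuation `0`, and every left factor has
nonnegative valuation. -/
def dyckLanguage {α : Type*} (h : α → ℤ) : Language α :=
  {w | valuation h w = 0 ∧ ∀ w₁ : List α, w₁ <+: w → 0 ≤ valuation h w₁}

/-- `w'` is a proper factor of `w`: `w = w₁ w' w₂` with `w₁`, `w₂` not both empty. -/
def IsProperFactor {α : Type*} (w' w : List α) : Prop :=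
  ∃ w₁ w₂ : List α, w = w₁ ++ w' ++ w₂ ∧ ¬(w₁ = [] ∧ w₂ = [])

/-- `w` has no proper factor that is a Dyck word. The empty word, which is a Dyck word and a
factor of every word, is not counted as such a factor. -/
def IsFactorFree {α : Type*} (h : α → ℤ) (w : List α) : Prop :=
  ∀ w' : List α, w' ≠ [] → IsProperFactor w' w → w' ∉ dyckLanguage h

/-- The language of factor-free Dyck words for `h` (it contains the empty word). -/
def factorFreeDyck {α : Type*} (h : α → ℤ) : Language α :=
  {w | w ∈ dyckLanguage h ∧ IsFactorFree h w}

/-- The valuation of slope `(2m+1)/2`: `h(a) = 2m+1` and `h(b) = -2`. -/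
def slopeVal (m : ℕ) : Letter → ℤ
  | Letter.a => 2 * (m : ℤ) + 1
  | Letter.b => -2

/-- The number of words of length `N` in the language `L` over `{a, b}`
(there are only finitely many words of a given length). -/
noncomputable def numWords (L : Language Letter) (N : ℕ) : ℕ :=
  Set.ncard {w : List Letter | w ∈ L ∧ w.length = N}

/-- The generating function `∑_{w ∈ L} τ ^ |w|` of a language over `{a, b}`. -/
noncomputable def lengthGF (L : Language Letter) : PowerSeries ℚ :=
  PowerSeries.mk fun N => (numWords L N : ℚ)

/-- `θ_n`: the number of factor-free Dyck words of slope `(2m+1)/2` and length `(2m+3)n`. -/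
noncomputable def theta (m n : ℕ) : ℕ :=
  numWords (factorFreeDyck (slopeVal m)) ((2 * m + 3) * n)

/-- The partial Bell polynomial `B_{n,k}(z_1, z_2, …)`: the sum of
`n! / (j_1! j_2! ⋯) * (z_1/1!)^{j_1} (z_2/2!)^{j_2} ⋯` over all `j_1, j_2, … ≥ 0` with
`j_1 + j_2 + ⋯ = k` and `j_1 + 2 j_2 + ⋯ = n`. Indices `i > n` are left out, since the second
constraint forces `j_i = 0` for them. The value `z 0` is not used. -/
noncomputable def partialBell (n k : ℕ) (z : ℕ → ℚ) : ℚ :=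
  ∑ j ∈ (Finset.piAntidiag (Finset.Icc 1 n) k).filter
      (fun j => ∑ i ∈ Finset.Icc 1 n, i * j i = n),
    (n.factorial : ℚ) / (∏ i ∈ Finset.Icc 1 n, ((j i).factorial : ℚ)) *
      ∏ i ∈ Finset.Icc 1 n, (z i / (i.factorial : ℚ)) ^ j i

/-- `μ_j`, the binomial coefficient of `m + j` over `m - j`, which is `0` for `j > m`. -/
def mu (m j : ℕ) : ℕ :=
  if j ≤ m then (m + j).choose (m - j) else 0

/-- `Δ_{ν,ℓ}` (for the given `m`). -/
noncomputable def Delta (m ν l : ℕ) : ℚ :=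
  (2 * (l : ℚ) + 1) / (2 * (ν : ℚ) + 2 * (l : ℚ) + 1) *
    ∑ k ∈ Finset.range (ν + 1),
      ((2 * ν + 2 * l + 1).choose k : ℚ) * ((k.factorial : ℚ) / (ν.factorial : ℚ)) *
        partialBell ν k (fun j => (j.factorial : ℚ) * (mu m j : ℚ))

end FactorFreeDyck

/-! Let `C_d` count, by letters `a`, the Dyck-free words that first reach level `-d` at their end
(`descent`, `descentGF`). Deleting the initial `a` of a nonempty factor-free Dyck word leaves
exactly a descent of depth `2m+1` (`mem_factorFreeDyck_iff`). A descent starting with `b` continues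
as a descent of depth `d-2`. One starting with `a` must later cross level 0 downwards; landing on 0
would close a Dyck factor, so it jumps from 1 to -1 and factors uniquely as `a w₁ b w₂` with depths
`2m` and `d-1`. Hence `C_d = C_{d-2} + X C_{2m} C_{d-1}` (`descentGF_rec`). With `A = C_1 = X
C_{2m}` this is a Fibonacci-type recurrence, so each `C_d` is a polynomial in `A` with binomial
coefficients (`recurrence_closed_form`). Depth `2m` gives `A = X ∑ μ_j A^{2j}`, and Lagrange
inversion identifies the coefficients of `A^{2l+1}` with `Delta`; depth `2m+1` then gives `θ_n`. -/

namespace FactorFreeDyck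

/-! ### Bell polynomials and powers of power series -/

open PowerSeries in
/-- Scaled partial Bell polynomials are the coefficients of powers of a power series. -/
theorem partialBell_eq_coeff_pow (c : ℕ → ℚ) (ν k : ℕ) :
    ((k.factorial : ℚ) / (ν.factorial : ℚ)) *
        partialBell ν k (fun j => (j.factorial : ℚ) * c j) =
      coeff ν ((∑ i ∈ Finset.Icc 1 ν, monomial i (c i)) ^ k) := by
  rw [Finset.sum_pow_eq_sum_piAntidiag, map_sum, partialBell, Finset.mul_sum, Finset.sum_filter]
  refine Finset.sum_congr rfl fun j hj => ?_
  have hk : ∑ i ∈ Finset.Icc 1 ν, j i = k := (Finset.mem_piAntidiag.1 hj).1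
  have hprod : ∏ i ∈ Finset.Icc 1 ν, (monomial i (c i)) ^ j i =
      monomial (∑ i ∈ Finset.Icc 1 ν, i * j i) (∏ i ∈ Finset.Icc 1 ν, c i ^ j i) := by
    simp_rw [monomial_pow]
    rw [prod_monomial]
    simp [mul_comm]
  rw [hprod, ← map_natCast (C (R := ℚ)), coeff_C_mul, coeff_monomial]
  by_cases h : ∑ i ∈ Finset.Icc 1 ν, i * j i = ν
  · have hs := Nat.multinomial_spec (Finset.Icc 1 ν) j
    rw [hk] at hs
    have hs' : (∏ i ∈ Finset.Icc 1 ν, ((j i).factorial : ℚ)) *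
        (Nat.multinomial (Finset.Icc 1 ν) j : ℚ) = (k.factorial : ℚ) := by
      rw [← hs]; push_cast; rfl
    have hne : (∏ i ∈ Finset.Icc 1 ν, ((j i).factorial : ℚ)) ≠ 0 :=
      Finset.prod_ne_zero_iff.2 fun i _ => by positivity
    have hν : (ν.factorial : ℚ) ≠ 0 := by positivity
    have hz : ∏ i ∈ Finset.Icc 1 ν, ((i.factorial : ℚ) * c i / (i.factorial : ℚ)) ^ j i =
        ∏ i ∈ Finset.Icc 1 ν, c i ^ j i :=
      Finset.prod_congr rfl fun i _ => by
        rw [mul_div_cancel_left₀]; positivity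
    rw [if_pos h, if_pos h.symm, hz, ← hs']
    field_simp
  · rw [if_neg h, if_neg (Ne.symm h), mul_zero]

-- Modulo `X^(ν+1)` the series is `1 + M` with `X ∣ M`, so the binomial theorem applies and the
-- terms with `k > ν` vanish.
open PowerSeries in
theorem coeff_mk_pow_eq_sum_choose (c : ℕ → ℚ) (hc : c 0 = 1) (ν N : ℕ) (hN : ν ≤ N) :
    coeff ν ((mk c) ^ N) = ∑ k ∈ Finset.range (ν + 1),
      (N.choose k : ℚ) * coeff ν ((∑ i ∈ Finset.Icc 1 ν, monomial i (c i)) ^ k) := by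
  set M : ℚ⟦X⟧ := ∑ i ∈ Finset.Icc 1 ν, monomial i (c i) with hM
  have hcoeff : ∀ i, coeff i M = if i ∈ Finset.Icc 1 ν then c i else 0 := by
    intro i
    rw [hM, map_sum]
    simp_rw [coeff_monomial]
    rw [Finset.sum_ite_eq]
  clear_value M
  have htrunc : trunc (ν + 1) (mk c) = trunc (ν + 1) (M + 1) := by
    ext i
    rw [coeff_trunc, coeff_trunc, map_add, hcoeff, coeff_mk, coeff_one]
    simp only [Finset.mem_Icc]
    split_ifs <;> first | omega | simp_all
  have hpow : coeff ν ((mk c) ^ N) = coeff ν ((M + 1) ^ N) := by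
    rw [← coeff_coe_trunc_of_lt (Nat.lt_succ_self ν), ← trunc_trunc_pow, htrunc, trunc_trunc_pow,
      coeff_coe_trunc_of_lt (Nat.lt_succ_self ν)]
  have hX : X ∣ M := by
    rw [X_dvd_iff, ← coeff_zero_eq_constantCoeff_apply, hcoeff]; simp
  rw [hpow, add_pow, map_sum]
  symm
  refine Finset.sum_subset_zero_on_sdiff (by simpa using hN) ?_ ?_
  · intro k hk
    have hlt : ν < k := by
      simp only [Finset.mem_sdiff, Finset.mem_range] at hk; omega
    rw [one_pow, mul_one, mul_comm, ← map_natCast (C (R := ℚ)), coeff_C_mul,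
      X_pow_dvd_iff.1 (pow_dvd_pow_of_dvd hX k) ν hlt, mul_zero]
  · intro k _
    rw [one_pow, mul_one, mul_comm (M ^ k), ← map_natCast (C (R := ℚ)), coeff_C_mul]

open PowerSeries in
theorem Delta_eq_coeff_pow (m ν l : ℕ) :
    Delta m ν l = (2 * (l : ℚ) + 1) / (2 * (ν : ℚ) + 2 * (l : ℚ) + 1) *
      coeff ν ((mk fun j => (mu m j : ℚ)) ^ (2 * ν + 2 * l + 1)) := by
  rw [Delta, coeff_mk_pow_eq_sum_choose _ (by simp [mu]) _ _ (by omega)]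
  congr 1
  refine Finset.sum_congr rfl fun k _ => ?_
  rw [mul_assoc, partialBell_eq_coeff_pow (fun j => (mu m j : ℚ))]

/-! ### Lagrange inversion -/

-- The weight `x.1` comes from applying `X d/dX` to `P^(n+1)`. This identity is the induction step
-- of the Lagrange inversion below.
open PowerSeries in
theorem sum_antidiagonal_mul_coeff_pow (p : ℕ → ℚ) (n k ν : ℕ) :
    (n + 1) * ∑ x ∈ Finset.HasAntidiagonal.antidiagonal ν, p x.1 * ((k + 2 * x.1) * coeff x.2 ((mk p) ^ n)) =
      (k * (n + 1) + 2 * ν) * coeff ν ((mk p) ^ (n + 1)) := by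
  have hder : (ν : ℚ) * coeff ν ((mk p) ^ (n + 1)) =
      (n + 1) * ∑ x ∈ Finset.HasAntidiagonal.antidiagonal ν, x.1 * p x.1 * coeff x.2 ((mk p) ^ n) := by
    have h1 : ∀ f : ℚ⟦X⟧, ∀ i, coeff i (X * d⁄dX ℚ f) = i * coeff i f := by
      intro f i
      cases i with
      | zero => simp
      | succ i => rw [coeff_succ_X_mul, coeff_derivative]; push_cast; ring
    rw [← h1, Derivation.leibniz_pow]
    have h2 : X * ((n + 1) • (mk p ^ (n + 1 - 1)) • d⁄dX ℚ (mk p)) =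
        C ((n : ℚ) + 1) * ((X * d⁄dX ℚ (mk p)) * mk p ^ n) := by
      simp only [Nat.add_sub_cancel, smul_eq_mul, nsmul_eq_mul, map_add, map_natCast, map_one]
      push_cast
      ring
    rw [h2, coeff_C_mul, coeff_mul]
    simp_rw [h1, coeff_mk]
  have hmul : coeff ν ((mk p) ^ (n + 1)) =
      ∑ x ∈ Finset.HasAntidiagonal.antidiagonal ν, p x.1 * coeff x.2 ((mk p) ^ n) := by
    rw [pow_succ', coeff_mul]; simp_rw [coeff_mk]
  have hsplit : ∑ x ∈ Finset.HasAntidiagonal.antidiagonal ν, p x.1 * ((k + 2 * x.1) * coeff x.2 ((mk p) ^ n)) =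
      k * ∑ x ∈ Finset.HasAntidiagonal.antidiagonal ν, p x.1 * coeff x.2 ((mk p) ^ n) +
      2 * ∑ x ∈ Finset.HasAntidiagonal.antidiagonal ν, x.1 * p x.1 * coeff x.2 ((mk p) ^ n) := by
    rw [Finset.mul_sum, Finset.mul_sum, ← Finset.sum_add_distrib]
    exact Finset.sum_congr rfl fun x _ => by ring
  rw [hsplit, ← hmul]
  linear_combination (-2) * hder

open PowerSeries in
/-- Lagrange inversion for the equation `A = X * P(A ^ 2)`, with `P` a polynomial. -/
theorem coeff_pow_of_eq_X_mul_sum (A : ℚ⟦X⟧) (p : ℕ → ℚ) (M : ℕ) (hp : ∀ j, M ≤ j → p j = 0)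
    (hA : A = X * ∑ j ∈ Finset.range M, C (p j) * A ^ (2 * j)) (n : ℕ) :
    ∀ k ν : ℕ, k + 2 * ν = n → (n : ℚ) * coeff n (A ^ k) = k * coeff ν ((mk p) ^ n) := by
  have hX : X ∣ A := ⟨_, hA⟩
  have hzero : ∀ i k, i < k → coeff i (A ^ k) = 0 := fun i k h =>
    X_pow_dvd_iff.1 (pow_dvd_pow_of_dvd hX k) i h
  have hrec : ∀ k ν, coeff (k + 2 * ν + 1) (A ^ (k + 1)) =
      ∑ x ∈ Finset.HasAntidiagonal.antidiagonal ν, p x.1 * coeff (k + 2 * ν) (A ^ (k + 2 * x.1)) := by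
    intro k ν
    have h1 : A ^ (k + 1) = X * ∑ j ∈ Finset.range M, C (p j) * A ^ (k + 2 * j) := by
      rw [pow_succ]
      nth_rw 2 [hA]
      rw [mul_left_comm, Finset.mul_sum]
      congr 1
      exact Finset.sum_congr rfl fun j _ => by ring
    rw [h1, coeff_succ_X_mul, map_sum, Finset.Nat.sum_antidiagonal_eq_sum_range_succ
      (fun j _ => p j * coeff (k + 2 * ν) (A ^ (k + 2 * j)))]
    simp_rw [coeff_C_mul]
    -- Both ranges are enlarged to a common one: `p j` vanishes from `M` on, and for `j > ν` the
    -- order of `A^(k+2j)` exceeds `k + 2ν`.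
    have hMM := Finset.sum_subset (s₁ := Finset.range M) (s₂ := Finset.range (M + ν.succ))
      (f := fun j => p j * coeff (k + 2 * ν) (A ^ (k + 2 * j))) (by simp)
      fun j _ hj => by rw [hp j (by simpa using hj), zero_mul]
    have hνν := Finset.sum_subset (s₁ := Finset.range ν.succ) (s₂ := Finset.range (M + ν.succ))
      (f := fun j => p j * coeff (k + 2 * ν) (A ^ (k + 2 * j))) (by simp)
      fun j _ hj => by
        rw [hzero _ _ (by simp only [Finset.mem_range] at hj; omega), mul_zero]
    rw [hMM, hνν]
  induction n with
  | zero =>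
    intro k ν h
    obtain rfl : k = 0 := by omega
    simp
  | succ n ih =>
    rintro (_ | k) ν h
    · rw [pow_zero, coeff_one, if_neg (by omega)]; simp
    · obtain rfl : k + 2 * ν = n := by omega
      rw [hrec]
      -- The induction hypothesis carries the factor `k + 2ν`, which must be nonzero to be
      -- cancelled.
      rcases Nat.eq_zero_or_pos (k + 2 * ν) with h0 | h0
      · obtain ⟨rfl, rfl⟩ : k = 0 ∧ ν = 0 := by omega
        simp
      · have h0' : ((k + 2 * ν : ℕ) : ℚ) ≠ 0 := by exact_mod_cast h0.ne'
        apply mul_left_cancel₀ h0'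
        have hih : ((k + 2 * ν : ℕ) : ℚ) *
            ∑ x ∈ Finset.HasAntidiagonal.antidiagonal ν, p x.1 * coeff (k + 2 * ν) (A ^ (k + 2 * x.1)) =
            ∑ x ∈ Finset.HasAntidiagonal.antidiagonal ν,
              p x.1 * ((k + 2 * x.1) * coeff x.2 ((mk p) ^ (k + 2 * ν))) := by
          rw [Finset.mul_sum]
          refine Finset.sum_congr rfl fun x hx => ?_
          have := ih (k + 2 * x.1) x.2 (by rw [← Finset.HasAntidiagonal.mem_antidiagonal.1 hx]; ring)
          rw [mul_left_comm, this]
          push_cast; ring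
        have hs := sum_antidiagonal_mul_coeff_pow p (k + 2 * ν) k ν
        rw [mul_left_comm, hih]
        push_cast at hs ⊢
        rw [hs]; ring

/-! ### The Fibonacci-type recurrence -/

/-- Solution of the recurrence `C (d + 2) = C d + A * C (d + 1)` with `C 0 = 1`, `C 1 = A`. -/
theorem recurrence_closed_form {R : Type*} [CommSemiring R] (A : R) (C : ℕ → R) (h0 : C 0 = 1)
    (h1 : C 1 = A) (h : ∀ d, C (d + 2) = C d + A * C (d + 1)) (r : ℕ) :
    C (2 * r) = ∑ j ∈ Finset.range (r + 1), ((r + j).choose (2 * j) : R) * A ^ (2 * j) ∧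
    C (2 * r + 1) =
      ∑ l ∈ Finset.range (r + 1), ((r + l + 1).choose (2 * l + 1) : R) * A ^ (2 * l + 1) := by
  induction r with
  | zero => simp [h0, h1]
  | succ r ih =>
    have he : C (2 * (r + 1)) =
        ∑ j ∈ Finset.range (r + 1 + 1), ((r + 1 + j).choose (2 * j) : R) * A ^ (2 * j) := by
      -- The constant term is split off and a vanishing top term kept, so that Pascal's rule applies
      -- termwise.
      have hext : C (2 * r) = 1 + ∑ j ∈ Finset.range (r + 1),
          ((r + (j + 1)).choose (2 * (j + 1)) : R) * A ^ (2 * (j + 1)) := by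
        rw [ih.1, Finset.sum_range_succ', Finset.sum_range_succ (n := r),
          Nat.choose_eq_zero_of_lt (n := r + (r + 1)) (by omega)]
        simp [add_comm]
      rw [show 2 * (r + 1) = 2 * r + 2 by ring, h, hext, ih.2, Finset.sum_range_succ' (n := r + 1),
        Finset.mul_sum]
      simp only [mul_zero, Nat.choose_zero_right, pow_zero, Nat.cast_one, mul_one]
      rw [add_comm (1 : R), add_right_comm, ← Finset.sum_add_distrib]
      congr 1
      refine Finset.sum_congr rfl fun j _ => ?_
      rw [show r + 1 + (j + 1) = (r + j + 1) + 1 by ring,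
        show 2 * (j + 1) = (2 * j + 1) + 1 by ring,
        Nat.choose_succ_succ' (r + j + 1) (2 * j + 1), ← add_assoc r j 1]
      push_cast
      ring
    refine ⟨he, ?_⟩
    rw [show 2 * (r + 1) + 1 = (2 * r + 1) + 2 by ring, h, show 2 * r + 1 + 1 = 2 * (r + 1) by ring,
      he, ih.2, Finset.mul_sum]
    have hext : ∑ l ∈ Finset.range (r + 1), ((r + l + 1).choose (2 * l + 1) : R) * A ^ (2 * l + 1) =
        ∑ l ∈ Finset.range (r + 1 + 1),
          ((r + l + 1).choose (2 * l + 1) : R) * A ^ (2 * l + 1) := by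
      rw [Finset.sum_range_succ (n := r + 1), Nat.choose_eq_zero_of_lt (n := r + (r + 1) + 1)
        (by omega)]
      simp
    rw [hext, ← Finset.sum_add_distrib]
    refine Finset.sum_congr rfl fun l _ => ?_
    rw [show r + 1 + l + 1 = (r + l + 1) + 1 by ring,
      Nat.choose_succ_succ' (r + l + 1) (2 * l),
      show r + 1 + l = r + l + 1 by ring]
    push_cast
    ring

theorem mu_eq_choose (m j : ℕ) : mu m j = (m + j).choose (2 * j) := by
  unfold mu
  split_ifs with h
  · rw [← Nat.choose_symm (by omega)]; congr 1; omega
  · rw [Nat.choose_eq_zero_of_lt (by omega)]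

/-! ### Dyck-free words and descents -/

theorem valuation_nil {α : Type*} (h : α → ℤ) : valuation h [] = 0 := rfl

theorem valuation_cons {α : Type*} (h : α → ℤ) (x : α) (w : List α) :
    valuation h (x :: w) = h x + valuation h w := by simp [valuation]

theorem valuation_append {α : Type*} (h : α → ℤ) (u v : List α) :
    valuation h (u ++ v) = valuation h u + valuation h v := by simp [valuation]

/-- No nonempty factor of `w`, including `w` itself, is a Dyck word. -/
def DyckFree {α : Type*} (h : α → ℤ) (w : List α) : Prop :=
  ∀ v, v <:+: w → v ≠ [] → v ∉ dyckLanguage h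

/-- The Dyck-free words that end at level `-d` and stay strictly above that level before. -/
def descent {α : Type*} (h : α → ℤ) (d : ℤ) : Set (List α) :=
  {w | valuation h w = -d ∧ (∀ v, v <+: w → v ≠ w → -d < valuation h v) ∧ DyckFree h w}

theorem DyckFree.of_infix {α : Type*} {h : α → ℤ} {u w : List α} (hw : DyckFree h w)
    (hu : u <:+: w) : DyckFree h u :=
  fun v hv => hw v (hv.trans hu)

theorem dyckFree_nil {α : Type*} (h : α → ℤ) : DyckFree h [] :=
  fun _ hv hne => absurd (List.infix_nil.1 hv) hne

theorem prefix_append_cases {α : Type*} {v l₁ l₂ : List α} (h : v <+: l₁ ++ l₂) :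
    v <+: l₁ ∨ ∃ t, t <+: l₂ ∧ v = l₁ ++ t := by
  obtain ⟨s, hs⟩ := h
  rcases List.append_eq_append_iff.1 hs with ⟨a, rfl, _⟩ | ⟨t, rfl, ht⟩
  · exact Or.inl ⟨a, rfl⟩
  · exact Or.inr ⟨t, ⟨s, ht.symm⟩, rfl⟩

/-- A path that ends at or below a negative level `T` has a first entry there. -/
theorem exists_first_entry {α : Type*} (h : α → ℤ) (w : List α) :
    ∀ T : ℤ, T < 0 → valuation h w ≤ T →
      ∃ p x r, w = p ++ x :: r ∧ (∀ v, v <+: p → T < valuation h v) ∧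
        valuation h p + h x ≤ T := by
  induction w with
  | nil => intro T hT h0; rw [valuation_nil] at h0; omega
  | cons y w ih =>
    intro T hT hw
    rw [valuation_cons] at hw
    by_cases hy : h y ≤ T
    · refine ⟨[], y, w, rfl, ?_, by simpa [valuation_nil] using hy⟩
      intro v hv
      rw [List.prefix_nil.1 hv, valuation_nil]; exact hT
    · obtain ⟨p, x, r, rfl, hp, hx⟩ := ih (T - h y) (by omega) (by omega)
      refine ⟨y :: p, x, r, rfl, ?_, by rw [valuation_cons]; omega⟩
      intro v hv
      rcases List.prefix_cons_iff.1 hv with rfl | ⟨t, rfl, ht⟩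
      · rw [valuation_nil]; exact hT
      · have := hp t ht
        rw [valuation_cons]; omega

theorem valuation_nonneg_of_prefix {α : Type*} {h : α → ℤ} {v w : List α}
    (hw : w ∈ dyckLanguage h) (hv : v <+: w) : 0 ≤ valuation h v := hw.2 v hv

/-- A factor through the marked `x` either starts at `x` or has a prefix `s x` with `s` a suffix of
`w₁`; this prefix has negative valuation. -/
theorem DyckFree.append_cons {α : Type*} {h : α → ℤ} {x : α} {w₂ : List α} (h₂ : DyckFree h w₂)
    (w₁ : List α) (h₁ : DyckFree h w₁) (hneg : ∀ s, s <:+ w₁ → valuation h s + h x < 0) :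
    DyckFree h (w₁ ++ x :: w₂) := by
  induction w₁ with
  | nil =>
    intro v hv hne hd
    rcases List.infix_cons_iff.1 hv with hv | hv
    · rcases List.prefix_cons_iff.1 hv with rfl | ⟨t, rfl, _⟩
      · exact hne rfl
      · have := valuation_nonneg_of_prefix (v := [x]) hd (by simp)
        have h' := hneg [] List.suffix_rfl
        simp only [valuation_cons, valuation_nil] at this h'
        omega
    · exact h₂ v hv hne hd
  | cons y w₁ ih =>
    have ih' := ih (h₁.of_infix (List.suffix_cons y w₁).isInfix)
      fun s hs => hneg s (hs.trans (List.suffix_cons y w₁))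
    intro v hv hne hd
    rcases List.infix_cons_iff.1 hv with hv | hv
    · rcases prefix_append_cases (l₁ := y :: w₁) hv with hv | ⟨t, ht, rfl⟩
      · exact h₁ v hv.isInfix hne hd
      · rcases List.prefix_cons_iff.1 ht with rfl | ⟨t, rfl, _⟩
        · exact h₁ _ (by simp) hne hd
        · have h' := hneg _ List.suffix_rfl
          have := valuation_nonneg_of_prefix (v := (y :: w₁) ++ [x]) hd ⟨t, by simp⟩
          rw [valuation_append, valuation_cons h x, valuation_nil] at this
          omega
    · exact ih' v hv hne hd

theorem descent_zero {α : Type*} (h : α → ℤ) : descent h 0 = {[]} := by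
  ext w
  constructor
  · rintro ⟨-, hp, -⟩
    by_contra hw
    have := hp [] List.nil_prefix (Ne.symm hw)
    rw [valuation_nil] at this
    omega
  · rintro rfl
    refine ⟨by simp [valuation_nil], ?_, dyckFree_nil h⟩
    intro v hv hne
    exact absurd (List.prefix_nil.1 hv) hne

theorem descent_eq_empty {α : Type*} (h : α → ℤ) {d : ℤ} (hd : d < 0) : descent h d = ∅ := by
  ext w
  simp only [Set.mem_empty_iff_false, iff_false]
  rintro ⟨hv, hp, -⟩
  by_cases hw : w = []
  · rw [hw, valuation_nil] at hv; omega
  · have := hp [] List.nil_prefix (Ne.symm hw)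
    rw [valuation_nil] at this
    omega

theorem le_valuation_of_prefix {α : Type*} {h : α → ℤ} {d : ℤ} {v w : List α}
    (hw : w ∈ descent h d) (hv : v <+: w) : -d ≤ valuation h v := by
  by_cases hvw : v = w
  · rw [hvw, hw.1]
  · exact (hw.2.1 v hv hvw).le

theorem valuation_suffix_nonpos {α : Type*} {h : α → ℤ} {d : ℤ} {s w : List α}
    (hw : w ∈ descent h d) (hs : s <:+ w) : valuation h s ≤ 0 := by
  obtain ⟨q, rfl⟩ := hs
  have h1 := hw.1
  have h2 := le_valuation_of_prefix hw (List.prefix_append q s)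
  rw [valuation_append] at h1
  omega

/-- The words of a descent language form a prefix code. -/
theorem descent_append_cancel {α : Type*} {h : α → ℤ} {d : ℤ} {w w' r r' : List α}
    (hw : w ∈ descent h d) (hw' : w' ∈ descent h d) (he : w ++ r = w' ++ r') : w = w' := by
  have key : ∀ {u v : List α}, u ∈ descent h d → v ∈ descent h d → u <+: v → u = v := by
    intro u v hu hv huv
    by_contra hne
    have := hv.2.1 u huv hne
    rw [hu.1] at this
    omega
  rcases List.prefix_or_prefix_of_prefix (l₁ := w) (l₂ := w') (l₃ := w ++ r)
    (List.prefix_append _ _) (he ▸ List.prefix_append _ _) with h1 | h1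
  · exact key hw hw' h1
  · exact (key hw' hw h1).symm

/-! ### First-letter decomposition of descents -/

variable {m : ℕ}

theorem cons_b_mem_descent_iff {d : ℤ} (hd : 0 < d) (w : List Letter) :
    Letter.b :: w ∈ descent (slopeVal m) d ↔ w ∈ descent (slopeVal m) (d - 2) := by
  constructor
  · rintro ⟨hv, hp, hf⟩
    rw [valuation_cons] at hv
    simp only [slopeVal] at hv
    refine ⟨by omega, ?_, hf.of_infix (List.suffix_cons _ _).isInfix⟩
    intro v hvw hne
    have := hp (Letter.b :: v) (by simpa using hvw) (by simpa using hne)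
    rw [valuation_cons] at this
    simp only [slopeVal] at this
    omega
  · rintro ⟨hv, hp, hf⟩
    refine ⟨by rw [valuation_cons]; simp only [slopeVal]; omega, ?_, ?_⟩
    · intro v hvw hne
      rcases List.prefix_cons_iff.1 hvw with rfl | ⟨t, rfl, ht⟩
      · rw [valuation_nil]; omega
      · have := hp t ht (by rintro rfl; exact hne rfl)
        rw [valuation_cons]
        simp only [slopeVal]
        omega
    · refine hf.append_cons [] (dyckFree_nil _) ?_
      intro s hs
      rw [List.suffix_nil.1 hs]
      simp [valuation_nil, slopeVal]

theorem cons_a_mem_descent {d : ℤ} (hd : 0 < d) {w₁ w₂ : List Letter}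
    (h₁ : w₁ ∈ descent (slopeVal m) (2 * m)) (h₂ : w₂ ∈ descent (slopeVal m) (d - 1)) :
    Letter.a :: (w₁ ++ Letter.b :: w₂) ∈ descent (slopeVal m) d := by
  have ha : slopeVal m Letter.a = 2 * m + 1 := rfl
  have hb : slopeVal m Letter.b = -2 := rfl
  have e₁ := h₁.1
  have e₂ := h₂.1
  refine ⟨?_, ?_, ?_⟩
  · rw [valuation_cons, valuation_append, valuation_cons]; omega
  · intro v hv hne
    rcases List.prefix_cons_iff.1 hv with rfl | ⟨t, rfl, ht⟩
    · rw [valuation_nil]; omega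
    · rcases prefix_append_cases ht with ht | ⟨s, hs, rfl⟩
      · have := le_valuation_of_prefix h₁ ht
        rw [valuation_cons]; omega
      · rcases List.prefix_cons_iff.1 hs with rfl | ⟨t, rfl, ht'⟩
        · rw [valuation_cons, List.append_nil]; omega
        · have := h₂.2.1 t ht' (by rintro rfl; exact hne rfl)
          rw [valuation_cons, valuation_append, valuation_cons]; omega
  -- A Dyck factor at the initial `a` cannot end within `a w₁`, whose nonempty prefixes have level
  -- at least 1, nor extend past `a w₁ b`, of level -1. Later factors are handled by `append_cons`.
  · intro v hv hne hdk
    rcases List.infix_cons_iff.1 hv with hv | hv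
    · rcases List.prefix_cons_iff.1 hv with rfl | ⟨t, rfl, ht⟩
      · exact hne rfl
      · rcases prefix_append_cases ht with ht | ⟨s, hs, rfl⟩
        · have := le_valuation_of_prefix h₁ ht
          have h0 := hdk.1
          rw [valuation_cons] at h0; omega
        · rcases List.prefix_cons_iff.1 hs with rfl | ⟨t, rfl, ht'⟩
          · have h0 := hdk.1
            rw [valuation_cons, List.append_nil] at h0; omega
          · have := valuation_nonneg_of_prefix (v := Letter.a :: (w₁ ++ [Letter.b])) hdk
              ⟨t, by simp⟩
            rw [valuation_cons, valuation_append, valuation_cons, valuation_nil] at this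
            omega
    · refine h₂.2.2.append_cons w₁ h₁.2.2 ?_ v hv hne hdk
      intro s hs
      have := valuation_suffix_nonpos h₁ hs
      omega

theorem exists_of_cons_a_mem_descent {d : ℤ} (hd : 0 < d) {w : List Letter}
    (hw : Letter.a :: w ∈ descent (slopeVal m) d) :
    ∃ w₁ ∈ descent (slopeVal m) (2 * m), ∃ w₂ ∈ descent (slopeVal m) (d - 1),
      w = w₁ ++ Letter.b :: w₂ := by
  have ha : slopeVal m Letter.a = 2 * m + 1 := rfl
  have hb : slopeVal m Letter.b = -2 := rfl
  obtain ⟨hv, hp, hf⟩ := hw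
  rw [valuation_cons] at hv
  -- Level `-(2m+1)` after the initial `a` is the starting level of the whole word.
  obtain ⟨p, x, r, rfl, hpp, hpx⟩ := exists_first_entry (slopeVal m) w (-(2 * m + 1)) (by omega)
    (by omega)
  have hp0 := hpp p List.prefix_rfl
  obtain rfl : x = Letter.b := by
    cases x
    · omega
    · rfl
  rw [valuation_append, valuation_cons] at hv
  -- Otherwise `a p b` would return exactly to level 0 and be a Dyck factor; hence `p` ends at
  -- `-2m`.
  have hne : valuation (slopeVal m) p ≠ -(2 * m + 1) + 2 := by
    intro h2
    refine hf (Letter.a :: (p ++ [Letter.b])) ⟨[], r, by simp⟩ (by simp) ⟨?_, ?_⟩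
    · rw [valuation_cons, valuation_append, valuation_cons, valuation_nil]; omega
    · intro v hv
      rcases List.prefix_cons_iff.1 hv with rfl | ⟨t, rfl, ht⟩
      · rw [valuation_nil]
      · rcases prefix_append_cases ht with ht | ⟨s, hs, rfl⟩
        · have := hpp t ht
          rw [valuation_cons]; omega
        · rcases List.prefix_cons_iff.1 hs with rfl | ⟨t, rfl, ht'⟩
          · rw [valuation_cons, List.append_nil]; omega
          · rw [List.prefix_nil.1 ht', valuation_cons, valuation_append, valuation_cons,
              valuation_nil]
            omega
  refine ⟨p, ⟨by omega, ?_, hf.of_infix ⟨[Letter.a], Letter.b :: r, by simp⟩⟩, r,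
    ⟨by omega, ?_, hf.of_infix ⟨Letter.a :: (p ++ [Letter.b]), [], by simp⟩⟩, rfl⟩
  · intro v hvp hvne
    have h1 := hpp v hvp
    obtain ⟨s, rfl⟩ := hvp
    -- If `p` reached `-2m` early, the rest `s` of `p` would have valuation 0 and never go below its
    -- start, hence be a Dyck factor.
    by_contra hcon
    have hs : s ≠ [] := by
      rintro rfl
      exact hvne (by simp)
    refine hf s ⟨Letter.a :: v, Letter.b :: r, by simp⟩ hs ⟨?_, ?_⟩
    · rw [valuation_append] at hne hp0 hpx; omega
    · rintro t ⟨t', rfl⟩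
      have := hpp (v ++ t) ⟨t', by simp⟩
      rw [valuation_append] at this
      omega
  · intro v hvr hvne
    have := hp (Letter.a :: (p ++ Letter.b :: v)) (by simpa using hvr)
      (by simpa using hvne)
    rw [valuation_cons, valuation_append, valuation_cons] at this
    omega

/-! ### Factor-free Dyck words as descents -/

theorem nil_mem_factorFreeDyck {α : Type*} (h : α → ℤ) : [] ∈ factorFreeDyck h := by
  refine ⟨⟨rfl, ?_⟩, ?_⟩
  · intro v hv
    rw [List.prefix_nil.1 hv, valuation_nil]
  · rintro v hv ⟨u, x, he, -⟩
    simp_all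

/-- An early return to level 0 would cut off a Dyck prefix. Conversely, a proper prefix of `a w'`
that is nonempty has positive level, and every other factor lies in `w'`. -/
theorem mem_factorFreeDyck_iff (w : List Letter) :
    w ∈ factorFreeDyck (slopeVal m) ↔
      w = [] ∨ ∃ w' ∈ descent (slopeVal m) (2 * m + 1), w = Letter.a :: w' := by
  have ha : slopeVal m Letter.a = 2 * m + 1 := rfl
  have hb : slopeVal m Letter.b = -2 := rfl
  constructor
  · rintro ⟨⟨hv, hp⟩, hf⟩
    rcases w with _ | ⟨_ | _, w⟩
    · exact Or.inl rfl
    · refine Or.inr ⟨w, ⟨?_, ?_, ?_⟩, rfl⟩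
      · rw [valuation_cons] at hv; omega
      · intro v hvw hne
        have h0 := hp (Letter.a :: v) (by simpa using hvw)
        rw [valuation_cons] at h0
        by_contra hcon
        obtain ⟨s, rfl⟩ := hvw
        refine hf (Letter.a :: v) (by simp) ⟨[], s, by simp, ?_⟩ ⟨?_, ?_⟩
        · rintro ⟨-, rfl⟩
          exact hne (by simp)
        · rw [valuation_cons]; omega
        · intro t ht
          exact hp t (ht.trans (by simp))
      · rintro v ⟨u, x, rfl⟩ hne
        exact hf v hne ⟨Letter.a :: u, x, by simp, by simp⟩
    · have := hp [Letter.b] (by simp)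
      rw [valuation_cons, valuation_nil] at this
      omega
  · rintro (rfl | ⟨w, hw, rfl⟩)
    · exact nil_mem_factorFreeDyck _
    · refine ⟨⟨?_, ?_⟩, ?_⟩
      · rw [valuation_cons, hw.1]; omega
      · intro v hv
        rcases List.prefix_cons_iff.1 hv with rfl | ⟨t, rfl, ht⟩
        · rw [valuation_nil]
        · have := le_valuation_of_prefix hw ht
          rw [valuation_cons]; omega
      · rintro v hne ⟨u, x, he, hux⟩ hdk
        rcases u with _ | ⟨y, u⟩
        · obtain ⟨y, v, rfl⟩ := List.exists_cons_of_ne_nil hne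
          simp only [List.nil_append, List.cons_append, List.cons.injEq] at he
          obtain ⟨rfl, rfl⟩ := he
          have hx : x ≠ [] := fun h => hux ⟨rfl, h⟩
          have := hw.2.1 v (by simp) (by simpa using hx)
          have h0 := hdk.1
          rw [valuation_cons] at h0
          omega
        · simp only [List.cons_append, List.cons.injEq] at he
          exact hw.2.2 v ⟨u, x, he.2.symm⟩ hne hdk

/-! ### Counting descents by letters `a` -/

theorem valuation_slopeVal (m : ℕ) (w : List Letter) :
    valuation (slopeVal m) w = (2 * m + 3) * (w.count Letter.a : ℤ) - 2 * (w.length : ℤ) := by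
  induction w with
  | nil => simp [valuation_nil]
  | cons x w ih =>
    rw [valuation_cons, ih]
    cases x
    · rw [List.count_cons_self, List.length_cons]; simp only [slopeVal]; push_cast; ring
    · rw [List.count_cons_of_ne (by decide), List.length_cons]
      simp only [slopeVal]; push_cast; ring

/-- The depth and the number of letters `a` determine the length. -/
theorem finite_descent_count (m : ℕ) (d : ℤ) (N : ℕ) :
    {w | w ∈ descent (slopeVal m) d ∧ w.count Letter.a = N}.Finite := by
  refine (List.finite_length_le Letter ((2 * m + 3) * N + d : ℤ).toNat).subset ?_
  rintro w ⟨hw, rfl⟩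
  have h1 := hw.1
  rw [valuation_slopeVal] at h1
  have : (w.length : ℤ) ≤ (2 * m + 3) * (w.count Letter.a : ℤ) + d := by omega
  simp only [Set.mem_ofPred_eq]
  omega

/-- The words of `descent (slopeVal m) d` with `N` letters `a`. -/
noncomputable def descentWords (m : ℕ) (d : ℤ) (N : ℕ) : Finset (List Letter) :=
  (finite_descent_count m d N).toFinset

theorem mem_descentWords {m : ℕ} {d : ℤ} {N : ℕ} {w : List Letter} :
    w ∈ descentWords m d N ↔ w ∈ descent (slopeVal m) d ∧ w.count Letter.a = N := by
  simp [descentWords]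

/-- The generating function of `descent (slopeVal m) d` by the number of letters `a`. -/
noncomputable def descentGF (m : ℕ) (d : ℤ) : PowerSeries ℚ :=
  PowerSeries.mk fun N => ((descentWords m d N).card : ℚ)

theorem card_descentWords_zero (m : ℕ) {d : ℤ} (hd : 0 < d) :
    (descentWords m d 0).card = (descentWords m (d - 2) 0).card := by
  rw [← Finset.card_image_of_injective (descentWords m (d - 2) 0)
    (List.cons_injective (a := Letter.b))]
  congr 1
  ext w
  simp only [Finset.mem_image, mem_descentWords]
  constructor
  · rintro ⟨hw, hc⟩
    rcases w with _ | ⟨_ | _, w⟩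
    · have := hw.1
      rw [valuation_nil] at this
      omega
    · simp at hc
    · exact ⟨w, ⟨(cons_b_mem_descent_iff hd w).1 hw, by simpa using hc⟩, rfl⟩
  · rintro ⟨w, ⟨hw, hc⟩, rfl⟩
    exact ⟨(cons_b_mem_descent_iff hd w).2 hw, by simpa using hc⟩

theorem card_descentWords_succ (m : ℕ) {d : ℤ} (hd : 0 < d) (N : ℕ) :
    (descentWords m d (N + 1)).card = (descentWords m (d - 2) (N + 1)).card +
      ∑ p ∈ Finset.HasAntidiagonal.antidiagonal N,
        (descentWords m (2 * m) p.1).card * (descentWords m (d - 1) p.2).card := by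
  classical
  let pairs := (Finset.HasAntidiagonal.antidiagonal N).sigma
    fun p => descentWords m (2 * m) p.1 ×ˢ descentWords m (d - 1) p.2
  let glue : (Σ _ : ℕ × ℕ, List Letter × List Letter) → List Letter :=
    fun q => Letter.a :: (q.2.1 ++ Letter.b :: q.2.2)
  have hpairs : ∀ i j u v, ⟨(i, j), u, v⟩ ∈ pairs ↔ i + j = N ∧
      (u ∈ descent (slopeVal m) (2 * m) ∧ u.count Letter.a = i) ∧
      (v ∈ descent (slopeVal m) (d - 1) ∧ v.count Letter.a = j) := by
    intro i j u v
    simp only [pairs, Finset.mem_sigma, Finset.HasAntidiagonal.mem_antidiagonal,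
      Finset.mem_product, mem_descentWords]
  -- The prefix-code property recovers `w₁`, hence also `w₂`.
  have hinj : Set.InjOn glue pairs := by
    rintro ⟨⟨i, j⟩, u, v⟩ hq ⟨⟨i', j'⟩, u', v'⟩ hq' he
    obtain ⟨-, ⟨hu, rfl⟩, hv, rfl⟩ := (hpairs _ _ _ _).1 hq
    obtain ⟨-, ⟨hu', rfl⟩, hv', rfl⟩ := (hpairs _ _ _ _).1 hq'
    have he' : u ++ Letter.b :: v = u' ++ Letter.b :: v' := List.cons_injective he
    obtain rfl := descent_append_cancel hu hu' he'
    obtain rfl : v = v' := List.cons_injective (List.append_cancel_left he')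
    rfl
  have hunion : descentWords m d (N + 1) =
      (descentWords m (d - 2) (N + 1)).image (List.cons Letter.b) ∪ pairs.image glue := by
    ext w
    simp only [Finset.mem_union, Finset.mem_image, mem_descentWords]
    constructor
    · rintro ⟨hw, hc⟩
      rcases w with _ | ⟨_ | _, w⟩
      · simp at hc
      · right
        obtain ⟨u, hu, v, hv, rfl⟩ := exists_of_cons_a_mem_descent hd hw
        refine ⟨⟨(u.count Letter.a, v.count Letter.a), u, v⟩,
          (hpairs _ _ _ _).2 ⟨?_, ⟨hu, rfl⟩, hv, rfl⟩, rfl⟩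
        rw [List.count_cons_self, List.count_append, List.count_cons_of_ne (by decide)] at hc
        exact Nat.succ_injective hc
      · exact Or.inl ⟨w, ⟨(cons_b_mem_descent_iff hd w).1 hw, by simpa using hc⟩, rfl⟩
    · rintro (⟨w, ⟨hw, hc⟩, rfl⟩ | ⟨⟨⟨i, j⟩, u, v⟩, hq, rfl⟩)
      · exact ⟨(cons_b_mem_descent_iff hd w).2 hw, by simpa using hc⟩
      · obtain ⟨hN, ⟨hu, hcu⟩, hv, hcv⟩ := (hpairs _ _ _ _).1 hq
        refine ⟨cons_a_mem_descent hd hu hv, ?_⟩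
        change (Letter.a :: (u ++ Letter.b :: v)).count Letter.a = N + 1
        rw [List.count_cons_self, List.count_append, List.count_cons_of_ne (by decide)]
        omega
  have hdisj : Disjoint ((descentWords m (d - 2) (N + 1)).image (List.cons Letter.b))
      (pairs.image glue) := by
    rw [Finset.disjoint_left]
    intro w h1 h2
    obtain ⟨u, -, rfl⟩ := Finset.mem_image.1 h1
    obtain ⟨q, -, hq⟩ := Finset.mem_image.1 h2
    simp [glue] at hq
  rw [hunion, Finset.card_union_of_disjoint hdisj, Finset.card_image_of_injOn hinj,
    Finset.card_image_of_injective _ List.cons_injective, Finset.card_sigma]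
  simp_rw [Finset.card_product]

/-! ### Generating functions of descents -/

open PowerSeries in
theorem descentGF_rec (m : ℕ) {d : ℤ} (hd : 0 < d) :
    descentGF m d = descentGF m (d - 2) + X * descentGF m (2 * m) * descentGF m (d - 1) := by
  ext N
  rw [map_add, mul_assoc]
  cases N with
  | zero =>
    rw [coeff_zero_X_mul, add_zero]
    simp only [descentGF, coeff_mk, card_descentWords_zero m hd]
  | succ N =>
    rw [coeff_succ_X_mul, coeff_mul]
    simp only [descentGF, coeff_mk, card_descentWords_succ m hd]
    push_cast
    rfl

theorem descentGF_zero (m : ℕ) : descentGF m 0 = 1 := by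
  ext N
  rw [descentGF, PowerSeries.coeff_mk, PowerSeries.coeff_one]
  have : descentWords m 0 N = if N = 0 then {[]} else ∅ := by
    ext w
    rw [mem_descentWords, descent_zero]
    split_ifs with h
    · subst h; simp +contextual
    · simp only [Set.mem_singleton_iff, Finset.notMem_empty, iff_false]
      rintro ⟨rfl, rfl⟩
      exact h rfl
  rw [this]
  split_ifs <;> simp

theorem descentGF_of_neg (m : ℕ) {d : ℤ} (hd : d < 0) : descentGF m d = 0 := by
  ext N
  have : descentWords m d N = ∅ := by
    ext w
    rw [mem_descentWords, descent_eq_empty _ hd]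
    simp
  rw [descentGF, PowerSeries.coeff_mk, this]
  simp

theorem descentGF_one (m : ℕ) : descentGF m 1 = PowerSeries.X * descentGF m (2 * m) := by
  rw [descentGF_rec m one_pos, descentGF_of_neg m (by norm_num), sub_self, descentGF_zero, zero_add,
    mul_one]

theorem descentGF_closed_form (m r : ℕ) :
    descentGF m (2 * r) = ∑ j ∈ Finset.range (r + 1),
        ((r + j).choose (2 * j) : PowerSeries ℚ) * descentGF m 1 ^ (2 * j) ∧
    descentGF m (2 * r + 1) = ∑ l ∈ Finset.range (r + 1),
        ((r + l + 1).choose (2 * l + 1) : PowerSeries ℚ) * descentGF m 1 ^ (2 * l + 1) := by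
  have := recurrence_closed_form (descentGF m 1) (fun d : ℕ => descentGF m d)
    (by simpa using descentGF_zero m) (by simp) (fun d => by
      rw [descentGF_rec m (d := ((d + 2 : ℕ) : ℤ)) (by positivity), ← descentGF_one,
        show ((d + 2 : ℕ) : ℤ) - 2 = d by push_cast; ring,
        show ((d + 2 : ℕ) : ℤ) - 1 = ((d + 1 : ℕ) : ℤ) by push_cast; ring]) r
  simpa only [Nat.cast_add, Nat.cast_mul, Nat.cast_ofNat, Nat.cast_one] using this

open PowerSeries in
theorem coeff_descentGF_one_pow (m ν l : ℕ) :
    coeff (2 * l + 1 + 2 * ν) (descentGF m 1 ^ (2 * l + 1)) = Delta m ν l := by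
  -- The closed form at depth `2m` turns `A = X C_{2m}` into an equation for `A` alone.
  have hA : descentGF m 1 = X * ∑ j ∈ Finset.range (m + 1),
      C (mu m j : ℚ) * descentGF m 1 ^ (2 * j) := by
    simp_rw [mu_eq_choose, map_natCast]
    rw [← (descentGF_closed_form m m).1, descentGF_one]
  have h := coeff_pow_of_eq_X_mul_sum (descentGF m 1) (fun j => (mu m j : ℚ)) (m + 1)
    (fun j hj => by rw [mu, if_neg (by omega), Nat.cast_zero]) hA (2 * l + 1 + 2 * ν) (2 * l + 1) ν
    rfl
  rw [Delta_eq_coeff_pow, show 2 * ν + 2 * l + 1 = 2 * l + 1 + 2 * ν by ring]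
  push_cast at h
  have hne : 2 * (ν : ℚ) + 2 * (l : ℚ) + 1 ≠ 0 := by positivity
  rw [div_mul_eq_mul_div, eq_div_iff hne, ← h]
  ring

/-! ### The numbers `θ_n` and the length generating function -/

theorem two_mul_length_of_mem_factorFreeDyck {m : ℕ} {w : List Letter}
    (hw : w ∈ factorFreeDyck (slopeVal m)) : 2 * w.length = (2 * m + 3) * w.count Letter.a := by
  have h := hw.1.1
  rw [valuation_slopeVal] at h
  zify
  omega

/-- A Dyck word of length `(2m+3)(n+1)` has `2n+2` letters `a`, and the initial one is removed. -/
theorem theta_succ (m n : ℕ) : theta m (n + 1) = (descentWords m (2 * m + 1) (2 * n + 1)).card := by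
  rw [theta, numWords, ← Finset.card_image_of_injective _ (List.cons_injective (a := Letter.a)),
    ← Set.ncard_coe_finset]
  congr 1
  ext w
  simp only [Set.mem_ofPred_eq, Finset.coe_image, Set.mem_image, Finset.mem_coe, mem_descentWords]
  constructor
  · rintro ⟨hw, hl⟩
    have h2 := two_mul_length_of_mem_factorFreeDyck hw
    rcases (mem_factorFreeDyck_iff w).1 hw with rfl | ⟨w, hd, rfl⟩
    · simp at hl
    · refine ⟨w, ⟨hd, ?_⟩, rfl⟩
      rw [hl, List.count_cons_self] at h2
      have : (2 * m + 3) * (w.count Letter.a + 1) = (2 * m + 3) * (2 * n + 2) := by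
        rw [← h2]; ring
      have := Nat.eq_of_mul_eq_mul_left (by omega) this
      omega
  · rintro ⟨w, ⟨hd, hc⟩, rfl⟩
    have hw := (mem_factorFreeDyck_iff (m := m) (Letter.a :: w)).2 (Or.inr ⟨w, hd, rfl⟩)
    have h2 := two_mul_length_of_mem_factorFreeDyck hw
    rw [List.count_cons_self, hc] at h2
    refine ⟨hw, Nat.eq_of_mul_eq_mul_left two_pos ?_⟩
    rw [h2]; ring

open PowerSeries in
theorem theta_succ_eq_sum (m n : ℕ) :
    (theta m (n + 1) : ℚ) = ∑ l ∈ Finset.range (min m n + 1),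
      ((m + l + 1).choose (m - l) : ℚ) * Delta m (n - l) l := by
  have h : (theta m (n + 1) : ℚ) = coeff (2 * n + 1) (descentGF m (2 * m + 1)) := by
    rw [theta_succ, descentGF, coeff_mk]
  rw [h, (descentGF_closed_form m m).2, map_sum]
  symm
  refine Finset.sum_subset_zero_on_sdiff (by simp) ?_ ?_
  -- Terms with `l > n` drop out because `X^(2l+1)` divides `A^(2l+1)`.
  · intro l hl
    simp only [Finset.mem_sdiff, Finset.mem_range] at hl
    have hX : X ∣ descentGF m 1 := ⟨_, descentGF_one m⟩
    rw [← map_natCast (C (R := ℚ)), coeff_C_mul,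
      X_pow_dvd_iff.1 (pow_dvd_pow_of_dvd hX _) (2 * n + 1) (by omega), mul_zero]
  · intro l hl
    have hln : l ≤ m ∧ l ≤ n := by
      simp only [Finset.mem_range] at hl; omega
    rw [← map_natCast (C (R := ℚ)), coeff_C_mul, ← coeff_descentGF_one_pow,
      show 2 * l + 1 + 2 * (n - l) = 2 * n + 1 by omega, ← Nat.choose_symm (by omega),
      show m + l + 1 - (m - l) = 2 * l + 1 by omega]

theorem lengthGF_factorFreeDyck (m : ℕ) :
    lengthGF (factorFreeDyck (slopeVal m)) =
      PowerSeries.subst (PowerSeries.X ^ (2 * m + 3) : PowerSeries ℚ)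
        (PowerSeries.mk fun n => if n = 0 then (1 : ℚ) else (theta m n : ℚ)) := by
  ext N
  rw [PowerSeries.coeff_subst_X_pow (by omega), lengthGF, PowerSeries.coeff_mk]
  split_ifs with hN
  · obtain ⟨n, rfl⟩ := hN
    rw [Nat.mul_div_cancel_left _ (by omega), PowerSeries.coeff_mk, Algebra.algebraMap_self,
      RingHom.id_apply]
    split_ifs with hn
    · subst hn
      have : {w | w ∈ factorFreeDyck (slopeVal m) ∧ w.length = (2 * m + 3) * 0} = {[]} := by
        ext w
        constructor
        · rintro ⟨-, hw⟩
          exact List.length_eq_zero_iff.1 hw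
        · rintro rfl
          exact ⟨nil_mem_factorFreeDyck _, rfl⟩
      rw [numWords, this, Set.ncard_singleton, Nat.cast_one]
    · rfl
  · have : {w | w ∈ factorFreeDyck (slopeVal m) ∧ w.length = N} = ∅ := by
      ext w
      simp only [Set.mem_ofPred_eq, Set.mem_empty_iff_false, iff_false]
      rintro ⟨hw, rfl⟩
      -- Twice the length is a multiple of the odd number `2m+3`, so the length itself is.
      refine hN (Nat.Coprime.dvd_of_dvd_mul_left (m := 2) ?_
        ⟨_, two_mul_length_of_mem_factorFreeDyck hw⟩)
      exact Nat.coprime_two_right.2 ⟨m + 1, by ring⟩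
    rw [numWords, this, Set.ncard_empty, Nat.cast_zero]

end FactorFreeDyck

/-- The first part says that the generating function of the language, by length, is
`1 + ∑_{n ≥ 1} θ_n t ^ n` with `t = τ ^ (2m+3)`; the second part is the formula for `θ_n`. -/
theorem corollary3p3 (m : ℕ) :
    FactorFreeDyck.lengthGF (FactorFreeDyck.factorFreeDyck (FactorFreeDyck.slopeVal m)) =
        PowerSeries.subst (PowerSeries.X ^ (2 * m + 3) : PowerSeries ℚ)
          (PowerSeries.mk fun n => if n = 0 then (1 : ℚ) else (FactorFreeDyck.theta m n : ℚ)) ∧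
      ∀ n : ℕ, 1 ≤ n →
        (FactorFreeDyck.theta m n : ℚ) =
          ∑ l ∈ Finset.range (min m (n - 1) + 1),
            ((m + l + 1).choose (m - l) : ℚ) * FactorFreeDyck.Delta m (n - l - 1) l := by
  refine ⟨FactorFreeDyck.lengthGF_factorFreeDyck m, ?_⟩
  rintro (_ | n) hn
  · omega
  · rw [FactorFreeDyck.theta_succ_eq_sum, Nat.add_sub_cancel]
    refine Finset.sum_congr rfl fun l _ => ?_
    rw [show n + 1 - l - 1 = n - l by omega]
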